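/- Let $k,m,n\ge 1$ be integers with $n<km$, let $a,c\in\mathbb{Z}$, and let $f(x)=(x^k+c)^m-ax^n\in\mathbb{Z}[x]$, a monic polynomial of degree $d=km$. Assume that $f$ is irreducible over $\mathbb{Q}$ and that the following conditions hold: 1. the integer $q=km-n$ is a prime number satisfying $\frac d2<q<d-2$; 2. there exists a prime $p$ such that $p\mid c$, $p\mid a$ and $p^2\nmid a$; 3. the integer $k(m-1)$ is odd; 4. there exists a prime $\ell$ such that $v_\ell(a)$ is odd and $\ell\nmid kmc$, where $v_\ell(a)$ denotes the exponent of $\ell$ in $a$. Then the Galois group over $\mathbb{Q}$ of (the splitting field of) $f$ is isomorphic to the symmetric group $S_d$. -/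

import Mathlib

open Polynomial

/-! The Galois group `G`, acting on the `d` roots, is shown to contain the alternating group and an
odd permutation.

At a prime above `p`, the Newton polygon of `f` has a segment of slope `1/q`: some root satisfies `v
x ^ q = v p`. So `q` divides the ramification index, hence the order of `G`
(`dvd_card_of_dvd_of_not_sq_dvd`). An element of order `q` is a single `q`-cycle because `d < 2 q`.
A transitive group with such a long cycle is primitive, and as the cycle fixes at least three
points, Jordan's theorem gives the alternating group.

At a prime above `l`, every root is a unit and the discriminant has the valuation of `a ^ (k (m -
1))` (`map_det_vandermonde_sq_eq_pow`). If `G` consisted of even permutations, the Vandermonde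
determinant of the roots would be rational, so `k (m - 1)` times the `l`-adic valuation of `a` would
be even; both factors are odd. -/

/-! ### Permutation groups containing a cycle of prime order -/

namespace Equiv.Perm

open MulAction

variable {α : Type*} [Fintype α] [DecidableEq α] {G : Subgroup (Perm α)}

/-- The pointwise stabilizer of the fixed points of a cycle of prime order acts primitively on
the support of the cycle. -/
theorem isPreprimitive_ofFixingSubgroup_of_isCycle_mem {p : ℕ} (hp : p.Prime) {g : Perm α}
    (hgc : g.IsCycle) (hgp : g.support.card = p) (hg : g ∈ G) :
    IsPreprimitive (fixingSubgroup G (g.support : Set α)ᶜ)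
      (SubMulAction.ofFixingSubgroup G (g.support : Set α)ᶜ) := by
  have := isPretransitive_of_isCycle_mem hgc hg
  apply IsPreprimitive.of_prime_card
  convert! hp
  rw [← hgp, ← Set.ncard_coe_finset, ← Nat.card_coe_set_eq]
  refine Nat.card_congr (Equiv.subtypeEquivRight fun x ↦ ?_)
  simp [SubMulAction.mem_ofFixingSubgroup_iff]

/-- A transitive permutation group that contains a cycle of prime order moving more than half of
the points is primitive. -/
theorem isPreprimitive_of_isCycle_mem [IsPretransitive G α] {p : ℕ} (hp : p.Prime)
    (hlt : Fintype.card α < 2 * p) {g : Perm α}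
    (hgc : g.IsCycle) (hgp : g.support.card = p) (hg : g ∈ G) : IsPreprimitive G α := by
  have := isPreprimitive_ofFixingSubgroup_of_isCycle_mem hp hgc hgp hg
  let f : SubMulAction.ofFixingSubgroup G (g.support : Set α)ᶜ →ₑ[
      (fixingSubgroup G (g.support : Set α)ᶜ).subtype] α :=
    { toFun := Subtype.val
      map_smul' := fun _ _ ↦ rfl }
  apply IsPreprimitive.of_card_lt (f := f)
  have : Set.range f = (g.support : Set α) := by
    ext x
    change x ∈ Set.range (Subtype.val : SubMulAction.ofFixingSubgroup G _ → α) ↔ _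
    simp [SubMulAction.mem_ofFixingSubgroup_iff]
  rw [this, Set.ncard_coe_finset, hgp, Nat.card_eq_fintype_card]
  exact hlt

/-- A Frattini argument: an element of `G` that preserves the support of a cycle `σ ∈ G` of prime
order can be modified on that support so as to normalize the group generated by `σ`. -/
theorem exists_eqOn_compl_support_conj_mem_zpowers {p : ℕ} (hp : p.Prime) {σ : Perm α}
    (hσc : σ.IsCycle) (hσp : σ.support.card = p) (hσ : σ ∈ G) {g : Perm α} (hg : g ∈ G)
    (hgσ : ∀ x, x ∉ σ.support → g⁻¹ x ∉ σ.support) :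
    ∃ h ∈ G, (∀ x, x ∉ σ.support → g x ∉ σ.support → h x = g x) ∧
      h * σ * h⁻¹ ∈ Subgroup.zpowers σ := by
  have := Fact.mk hp
  let K : Subgroup (Perm α) := G ⊓ fixingSubgroup (Perm α) (σ.support : Set α)ᶜ
  have hK : ∀ k, k ∈ K ↔ k ∈ G ∧ ∀ x, x ∉ σ.support → k x = x := by
    intro k
    simp [K, Subgroup.mem_inf, mem_fixingSubgroup_iff]
  have hσK : σ ∈ K := (hK σ).2 ⟨hσ, fun x hx ↦ notMem_support.1 hx⟩
  have hτK : g * σ * g⁻¹ ∈ K := by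
    refine (hK _).2 ⟨G.mul_mem (G.mul_mem hg hσ) (G.inv_mem hg), fun x hx ↦ ?_⟩
    rw [mul_apply, mul_apply, notMem_support.1 (hgσ x hx), ← mul_apply, mul_inv_cancel, one_apply]
  -- `K` embeds in the symmetric group on `p` points and contains `σ`, so its Sylow `p`-subgroups
  -- have order exactly `p`. Thus `σ` and `g * σ * g⁻¹` generate Sylow subgroups, which are
  -- conjugate in `K`.
  have hcardK : (Nat.card K).factorization p = 1 := by
    have h1 : Nat.card K ∣ p.factorial := by
      have hle : K ≤ (ofSubtype : Perm {x // x ∈ σ.support} →* Perm α).range := by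
        intro k hk
        rw [MonoidHom.mem_range]
        refine (mem_range_ofSubtype_iff).2 fun x hx ↦ ?_
        by_contra hx'
        exact (mem_support.1 hx) (((hK k).1 hk).2 x hx')
      refine (Subgroup.card_dvd_of_le hle).trans ?_
      rw [← Nat.card_congr (MonoidHom.ofInjective
        (ofSubtype_injective (p := (· ∈ σ.support)))).toEquiv, Nat.card_perm,
        Nat.card_eq_fintype_card, Fintype.card_coe, hσp]
    have h2 : p ∣ Nat.card K := by
      rw [← hσp, ← hσc.orderOf, ← Subgroup.orderOf_mk σ hσK]
      exact orderOf_dvd_natCard _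
    have h3 : ¬ p ^ 2 ∣ Nat.card K := by
      intro h
      have h4 := h.trans h1
      rw [← Nat.mul_factorial_pred hp.ne_zero, sq, Nat.mul_dvd_mul_iff_left hp.pos,
        hp.dvd_factorial] at h4
      have := hp.pos
      omega
    have h0 : Nat.card K ≠ 0 := Nat.card_pos.ne'
    apply le_antisymm
    · by_contra! h
      exact h3 ((hp.pow_dvd_iff_le_factorization h0).2 h)
    · exact (hp.pow_dvd_iff_le_factorization h0).1 (by simpa using h2)
  have hord : ∀ τ (hτ : τ ∈ K), orderOf τ = p →
      Nat.card (Subgroup.zpowers (⟨τ, hτ⟩ : K)) = p ^ (Nat.card K).factorization p := by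
    intro τ hτ h
    rw [hcardK, pow_one, Nat.card_zpowers, Subgroup.orderOf_mk, h]
  have hoσ : orderOf σ = p := by rw [hσc.orderOf, hσp]
  have hoτ : orderOf (g * σ * g⁻¹) = p := by
    rw [← hoσ]
    exact (MulAut.conj g).orderOf_eq σ
  obtain ⟨k, hk⟩ := exists_smul_eq K (Sylow.ofCard _ (hord _ hτK hoτ))
    (Sylow.ofCard _ (hord _ hσK hoσ))
  refine ⟨k * g, G.mul_mem ((hK _).1 k.2).1 hg, fun x _ hx ↦ ((hK _).1 k.2).2 _ hx, ?_⟩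
  have hmem : k * ⟨g * σ * g⁻¹, hτK⟩ * k⁻¹ ∈ (Sylow.ofCard _ (hord _ hσK hoσ) : Sylow p K) := by
    rw [← hk, Sylow.smul_def]
    exact Subgroup.smul_mem_pointwise_smul _ (MulAut.conj k) _ (Subgroup.mem_zpowers _)
  obtain ⟨i, hi⟩ := Subgroup.mem_zpowers_iff.1 hmem
  refine Subgroup.mem_zpowers_iff.2 ⟨i, ?_⟩
  have := congrArg (Subtype.val : K → Perm α) hi
  simpa [mul_assoc] using this

/-- **Jordan's theorem**: a primitive permutation group that contains a cycle of prime order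
fixing at least three points contains the alternating group. -/
theorem alternatingGroup_le_of_isPreprimitive_of_isCycle_mem (hG : IsPreprimitive G α)
    {p : ℕ} (hp : p.Prime) (hp' : p + 3 ≤ Nat.card α) {σ : Perm α} (hσc : σ.IsCycle)
    (hσp : σ.support.card = p) (hσ : σ ∈ G) : alternatingGroup α ≤ G := by
  -- The general argument ends with the power `t ^ (2 * p)` of a 3-cycle `t`, which is trivial when
  -- `p = 3`.
  rcases eq_or_ne p 3 with rfl | hp3
  · exact alternatingGroup_le_of_isPreprimitive_of_isThreeCycle_mem hG
      (card_support_eq_three_iff.1 hσp) hσ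
  obtain ⟨n, hn⟩ := Nat.exists_eq_add_of_le hp'
  have hΔ : σ.supportᶜ.card = n + 3 := by
    rw [Finset.card_compl, hσp, ← Nat.card_eq_fintype_card, hn]
    omega
  have hΔ' : ((σ.support : Set α)ᶜ).ncard = n + 2 + 1 := by
    rw [← Finset.coe_compl, Set.ncard_coe_finset, hΔ]
  -- `σ` fixes `n + 3` points, so Jordan's multiple primitivity criterion yields degree `n + 4`.
  -- Transitivity on `n + 3` points is enough to prescribe the action on all fixed points of `σ`.
  have hmul : IsMultiplyPreprimitive G α (n + 2 + 2) :=
    hG.isMultiplyPreprimitive hΔ' (by have := hp.two_le; omega)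
      (isPreprimitive_ofFixingSubgroup_of_isCycle_mem hp hσc hσp hσ)
  have htrans : IsMultiplyPretransitive G α (n + 2 + 2) := hmul.isMultiplyPretransitive
  have htrans' : IsMultiplyPretransitive G α (n + 3) :=
    isMultiplyPretransitive_of_le (n := n + 2 + 2) (by omega)
      (by have := hp.two_le; omega)
  -- every permutation preserving the fixed points of `σ` agrees there with some element of `G`
  -- that normalizes `⟨σ⟩`
  have hext : ∀ τ : Perm α, (∀ x, x ∉ σ.support ↔ τ x ∉ σ.support) →
      ∃ h ∈ G, (∀ x, x ∉ σ.support → h x = τ x) ∧ h * σ * h⁻¹ ∈ Subgroup.zpowers σ := by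
    intro τ hτ
    let e : Fin (n + 3) ↪ α :=
      (σ.supportᶜ.equivFinOfCardEq hΔ).symm.toEmbedding.trans (Function.Embedding.subtype _)
    obtain ⟨⟨g, hg⟩, hge⟩ := exists_smul_eq G e (e.trans τ.toEmbedding)
    have hgτ : ∀ x, x ∉ σ.support → g x = τ x := by
      intro x hx
      have := DFunLike.congr_fun hge
        (σ.supportᶜ.equivFinOfCardEq hΔ ⟨x, Finset.mem_compl.2 hx⟩)
      simpa [e] using this
    obtain ⟨h, hhG, hh, hhσ⟩ := exists_eqOn_compl_support_conj_mem_zpowers hp hσc hσp hσ hg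
      (fun x hx ↦ by
        have h1 : τ⁻¹ x ∉ σ.support := by rw [hτ]; simpa using hx
        have h2 := hgτ _ h1
        rw [← mul_apply τ, mul_inv_cancel, one_apply] at h2
        rwa [← h2, ← mul_apply, inv_mul_cancel, one_apply])
    refine ⟨h, hhG, fun x hx ↦ ?_, hhσ⟩
    rw [← hgτ x hx]
    exact hh x hx (by rw [hgτ x hx, ← hτ]; exact hx)
  obtain ⟨x, hx, y, hy, z, hz, hxy, hxz, hyz⟩ :=
    (Finset.two_lt_card (s := σ.supportᶜ)).1 (by omega)
  rw [Finset.mem_compl] at hx hy hz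
  have hswap : ∀ {a b : α}, a ∉ σ.support → b ∉ σ.support →
      ∀ w, w ∉ σ.support ↔ swap a b w ∉ σ.support := by
    intro a b ha hb w
    rcases eq_or_ne w a with rfl | hwa
    · simp [ha, hb]
    rcases eq_or_ne w b with rfl | hwb
    · simp [ha, hb]
    rw [swap_apply_of_ne_of_ne hwa hwb]
  obtain ⟨g₁, hg₁, hg₁', i, hi⟩ := hext _ (hswap hx hy)
  obtain ⟨g₂, hg₂, hg₂', j, hj⟩ := hext _ (hswap hx hz)
  -- Automorphisms of a cyclic group are power maps and commute, so the commutator of `g₁` and `g₂`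
  -- centralizes `σ`.
  have hconj : g₁ * g₂ * σ * (g₁ * g₂)⁻¹ = g₂ * g₁ * σ * (g₂ * g₁)⁻¹ := by
    have h1 : g₁ * g₂ * σ * (g₁ * g₂)⁻¹ = (σ ^ i) ^ j := by
      calc _ = MulAut.conj g₁ (g₂ * σ * g₂⁻¹) := by simp [mul_assoc]
        _ = (MulAut.conj g₁ σ) ^ j := by rw [← hj, map_zpow]
        _ = _ := by rw [MulAut.conj_apply, ← hi]
    have h2 : g₂ * g₁ * σ * (g₂ * g₁)⁻¹ = (σ ^ j) ^ i := by
      calc _ = MulAut.conj g₂ (g₁ * σ * g₁⁻¹) := by simp [mul_assoc]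
        _ = (MulAut.conj g₂ σ) ^ i := by rw [← hi, map_zpow]
        _ = _ := by rw [MulAut.conj_apply, ← hj]
    rw [h1, h2, ← zpow_mul, ← zpow_mul, mul_comm]
  set c := (g₂ * g₁)⁻¹ * (g₁ * g₂) with hc
  set t := swap x y * swap x z with ht
  have hcG : c ∈ G := G.mul_mem (G.inv_mem (G.mul_mem hg₂ hg₁)) (G.mul_mem hg₁ hg₂)
  have hcσ : Commute c σ := by
    calc c * σ = (g₂ * g₁)⁻¹ * (g₁ * g₂ * σ * (g₁ * g₂)⁻¹) * (g₁ * g₂) := by rw [hc]; group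
      _ = σ * c := by rw [hconj, hc]; group
  have htσ : ∀ w, w ∉ σ.support ↔ t w ∉ σ.support := fun w ↦
    (hswap hx hz w).trans (hswap hx hy _)
  -- On the fixed points of `σ`, `g₁ * g₂` acts as `t` and `g₂ * g₁` as `t⁻¹`, so `c` acts as `t ^
  -- 2`.
  have hct : ∀ w, w ∉ σ.support → c w = (t ^ 2) w := by
    intro w hw
    rw [hc, mul_apply, inv_eq_iff_eq]
    have h1 : (g₁ * g₂) w = t w := by
      rw [mul_apply, hg₂' w hw, hg₁' _ ((hswap hx hz w).1 hw), ht, mul_apply]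
    have h2 : ∀ u, u ∉ σ.support → (g₂ * g₁) u = (swap x z * swap x y) u := by
      intro u hu
      rw [mul_apply, hg₁' u hu, hg₂' _ ((hswap hx hy u).1 hu), mul_apply]
    rw [h1, h2 _ (by rw [sq, mul_apply, ← htσ, ← htσ]; exact hw), ht]
    simp [sq]
  have h3 : t.IsThreeCycle := isThreeCycle_swap_mul_swap_same hxy hxz hyz
  have htfix : ∀ w, w ∈ σ.support → t w = w := by
    intro w hw
    have hwx : w ≠ x := fun h ↦ hx (h ▸ hw)
    have hwy : w ≠ y := fun h ↦ hy (h ▸ hw)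
    have hwz : w ≠ z := fun h ↦ hz (h ▸ hw)
    rw [ht, mul_apply, swap_apply_of_ne_of_ne hwx hwz, swap_apply_of_ne_of_ne hwx hwy]
  -- Commuting with the cycle `σ`, `c` acts on its support as a power of `σ`, so `c ^ p` is trivial
  -- there.
  have hcfix : ∀ w, w ∈ σ.support → (c ^ p) w = w := by
    intro w hw
    have hcw : c w ∈ σ.support := by
      rw [mem_support, ← mul_apply, ← hcσ.eq, mul_apply]
      exact fun h ↦ mem_support.1 hw (c.injective h)
    obtain ⟨i, hi⟩ := hσc.sameCycle (mem_support.1 hw) (mem_support.1 hcw)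
    have hpow : ∀ k : ℕ, (c ^ k) w = ((σ ^ i) ^ k) w := by
      intro k
      induction k with
      | zero => rfl
      | succ k ih =>
        rw [pow_succ', mul_apply, ih, ← mul_apply, ((hcσ.zpow_right i).pow_right k).eq, mul_apply,
          ← hi, ← mul_apply, ← pow_succ]
    rw [hpow, ← zpow_natCast, zpow_comm, zpow_natCast, ← hσp, ← hσc.orderOf, pow_orderOf_eq_one,
      one_zpow, one_apply]
  have hcp : c ^ p = (t ^ 2) ^ p := by
    ext w
    by_cases hw : w ∈ σ.support
    · rw [hcfix w hw, ← pow_mul]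
      exact (Function.IsFixedPt.perm_pow (htfix w hw) _).symm
    · have hpow : ∀ k : ℕ, (c ^ k) w = ((t ^ 2) ^ k) w ∧ (c ^ k) w ∉ σ.support := by
        intro k
        induction k with
        | zero => exact ⟨rfl, hw⟩
        | succ k ih =>
          have := hct _ ih.2
          rw [pow_succ', mul_apply, this]
          refine ⟨by rw [ih.1, pow_succ' (t ^ 2), mul_apply], ?_⟩
          rw [sq, mul_apply, ← htσ, ← htσ]
          exact ih.2
      rw [(hpow p).1]
  refine alternatingGroup_le_of_isPreprimitive_of_isThreeCycle_mem hG (g := c ^ p) ?_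
    (G.pow_mem hcG p)
  have hdvd : ¬ 3 ∣ 2 * p := by
    intro h
    rcases (Nat.prime_three.dvd_mul).1 h with h | h
    · omega
    · exact hp3 ((Nat.prime_dvd_prime_iff_eq Nat.prime_three hp).1 h).symm
  rw [hcp, ← pow_mul, ← pow_mod_orderOf, h3.orderOf]
  have : 2 * p % 3 = 1 ∨ 2 * p % 3 = 2 := by omega
  rcases this with h | h <;> rw [h]
  · rwa [pow_one]
  · rw [sq]
    exact h3.isThreeCycle_sq

theorem eq_top_of_alternatingGroup_le_of_not_le (hle : alternatingGroup α ≤ G)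
    (hnot : ¬ G ≤ alternatingGroup α) : G = ⊤ := by
  obtain ⟨σ, hσ, hσA⟩ := SetLike.not_le_iff_exists.1 hnot
  rw [mem_alternatingGroup] at hσA
  have hσ1 := (Int.units_eq_one_or (sign σ)).resolve_left hσA
  refine (Subgroup.eq_top_iff' G).2 fun τ ↦ ?_
  rcases Int.units_eq_one_or (sign τ) with h | h
  · exact hle (mem_alternatingGroup.2 h)
  · rw [← mul_inv_cancel_right τ σ]
    exact G.mul_mem (hle (mem_alternatingGroup.2 (by simp [h, hσ1]))) (G.inv_mem hσ)

end Equiv.Perm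

/-! ### Degree and low coefficients of the polynomial -/

namespace Polynomial

variable {R : Type*} [CommRing R] {k m n : ℕ}

theorem map_X_pow_add_C_pow_sub {S : Type*} [CommRing S] (φ : R →+* S) (a c : R) :
    ((X ^ k + C c) ^ m - C a * X ^ n).map φ = (X ^ k + C (φ c)) ^ m - C (φ a) * X ^ n := by
  simp

theorem natDegree_X_pow_add_C_pow [Nontrivial R] (hk : k ≠ 0) (c : R) :
    ((X ^ k + C c) ^ m).natDegree = k * m := by
  rw [(monic_X_pow_add_C c hk).natDegree_pow, natDegree_X_pow_add_C, mul_comm]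

theorem natDegree_C_mul_X_pow_lt [Nontrivial R] (hn : n < k * m) (a c : R) :
    (C a * X ^ n).natDegree < ((X ^ k + C c) ^ m).natDegree := by
  have hk : k ≠ 0 := by rintro rfl; simp at hn
  rw [natDegree_X_pow_add_C_pow hk]
  exact (natDegree_C_mul_X_pow_le a n).trans_lt hn

theorem natDegree_X_pow_add_C_pow_sub [Nontrivial R] (hn : n < k * m) (a c : R) :
    ((X ^ k + C c) ^ m - C a * X ^ n).natDegree = k * m := by
  have hk : k ≠ 0 := by rintro rfl; simp at hn
  rw [natDegree_sub_eq_left_of_natDegree_lt (natDegree_C_mul_X_pow_lt hn a c),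
    natDegree_X_pow_add_C_pow hk]

theorem monic_X_pow_add_C_pow_sub [Nontrivial R] (hn : n < k * m) (a c : R) :
    ((X ^ k + C c) ^ m - C a * X ^ n).Monic := by
  have hk : k ≠ 0 := by rintro rfl; simp at hn
  exact ((monic_X_pow_add_C c hk).pow m).sub_of_left
    (degree_lt_degree (natDegree_C_mul_X_pow_lt hn a c))

/-- The coefficients of `(X ^ k + c) ^ m` below the middle degree are divisible by `c ^ 2`. -/
theorem sq_dvd_coeff_X_pow_add_C_pow (hk : k ≠ 0) (hm : 2 ≤ m) (hn : 2 * n < k * m) (c : R) :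
    c ^ 2 ∣ ((X ^ k + C c) ^ m).coeff n := by
  have h : (X ^ k + C c) ^ m = expand R k ((X + C c) ^ m) := by simp
  rw [h, coeff_expand (Nat.pos_of_ne_zero hk)]
  split_ifs with hkn
  · obtain ⟨j, rfl⟩ := hkn
    rw [Nat.mul_div_cancel_left _ (Nat.pos_of_ne_zero hk), coeff_X_add_C_pow]
    -- The coefficient carries `c ^ (m - j)`, and `2 * j < m` with `2 ≤ m` forces `m - j ≥ 2`.
    have hj : 2 * j < m := by
      refine lt_of_mul_lt_mul_left (a := k) ?_ (Nat.zero_le k)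
      linarith
    exact (pow_dvd_pow c (by omega)).mul_right _
  · exact dvd_zero _

end Polynomial

/-! ### Valuations of the roots and of the discriminant -/

namespace Valuation

variable {K Γ₀ : Type*} [Field K] [LinearOrderedCommGroupWithZero Γ₀] (v : Valuation K Γ₀)

theorem map_intCast_le_one (z : ℤ) : v z ≤ 1 :=
  intCast_mem v.integer z

theorem map_intCast_eq_one_of_not_dvd {l : ℕ} (hl : l.Prime) (hvl : v (l : K) < 1) {z : ℤ}
    (hz : ¬ (l : ℤ) ∣ z) : v z = 1 := by
  refine le_antisymm (v.map_intCast_le_one z) (not_lt.1 fun h ↦ ?_)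
  obtain ⟨x, y, hxy⟩ := (Nat.prime_iff_prime_int.1 hl).coprime_iff_not_dvd.2 hz
  have hxy' : (x * l + y * z : K) = 1 := by exact_mod_cast congrArg (Int.cast : ℤ → K) hxy
  refine lt_irrefl (1 : Γ₀) ?_
  calc (1 : Γ₀) = v (x * l + y * z : K) := by rw [hxy', map_one]
    _ < 1 := v.map_add_lt
      (by rw [map_mul]; exact mul_lt_one_of_nonneg_of_lt_one_right (v.map_intCast_le_one x) zero_le hvl)
      (by rw [map_mul]; exact mul_lt_one_of_nonneg_of_lt_one_right (v.map_intCast_le_one y) zero_le h)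

theorem map_intCast_eq_pow_padicValInt {l : ℕ} (hl : l.Prime) (hvl : v (l : K) < 1) {z : ℤ}
    (hz : z ≠ 0) : v z = v (l : K) ^ padicValInt l z := by
  have := Fact.mk hl
  obtain ⟨u, hu⟩ := padicValInt_dvd (p := l) z
  have hlu : ¬ (l : ℤ) ∣ u := by
    rintro ⟨w, rfl⟩
    have h : (l : ℤ) ^ (padicValInt l z + 1) ∣ z :=
      ⟨w, by conv_lhs => rw [hu]
             rw [pow_succ, mul_assoc]⟩
    rw [padicValInt_dvd_iff] at h
    rcases h with h | h
    · exact hz h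
    · omega
  conv_lhs => rw [hu]
  rw [Int.cast_mul, map_mul, v.map_intCast_eq_one_of_not_dvd hl hvl hlu]
  simp

/-- If the square of a rational number has the valuation of an odd power of an integer `a`, then
`a` has even `l`-adic valuation. -/
theorem even_padicValInt_of_sq_eq_pow [CharZero K] {l : ℕ} (hl : l.Prime) (hvl : v (l : K) < 1)
    {a : ℤ} (ha : a ≠ 0) {r : ℚ} {N : ℕ} (hN : Odd N) (h : v (r : K) ^ 2 = v (a : K) ^ N) :
    Even (padicValInt l a) := by
  have hl0 : v (l : K) ≠ 0 := by simpa using hl.ne_zero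
  have ha0 : v (a : K) ≠ 0 := by simpa using ha
  have hr : r ≠ 0 := by
    rintro rfl
    simp only [Rat.cast_zero, map_zero, ne_eq, OfNat.ofNat_ne_zero, not_false_eq_true,
      zero_pow] at h
    exact pow_ne_zero _ ha0 h.symm
  have hden : (r.den : ℤ) ≠ 0 := by exact_mod_cast r.den_ne_zero
  have hrn : v (r : K) * v ((r.den : ℤ) : K) = v (r.num : K) := by
    rw [← map_mul]
    congr 1
    exact_mod_cast congrArg (Rat.cast : ℚ → K) (Rat.mul_den_eq_num r)
  have h2 : v (a : K) ^ N * v ((r.den : ℤ) : K) ^ 2 = v (r.num : K) ^ 2 := by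
    rw [← h, ← mul_pow, hrn]
  rw [v.map_intCast_eq_pow_padicValInt hl hvl ha, v.map_intCast_eq_pow_padicValInt hl hvl hden,
    v.map_intCast_eq_pow_padicValInt hl hvl (Rat.num_ne_zero.2 hr), ← pow_mul, ← pow_mul,
    ← pow_mul, ← pow_add] at h2
  -- With denominators cleared, both sides are powers of `v l`. Comparing exponents makes
  -- `padicValInt l a * N` a difference of even numbers.
  have h3 := (pow_right_strictAnti₀ (zero_lt_iff.2 hl0) hvl).injective h2
  by_contra hodd
  have h4 : Odd (padicValInt l a * N) := (Nat.not_even_iff_odd.1 hodd).mul hN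
  obtain ⟨w, hw⟩ := h4
  omega

theorem map_multiset_sum_lt {s : Multiset K} {g : Γ₀} (hg : g ≠ 0) (h : ∀ x ∈ s, v x < g) :
    v s.sum < g := by
  induction s using Multiset.induction_on with
  | empty => simpa using zero_lt_iff.2 hg
  | cons x s ih =>
    rw [Multiset.sum_cons]
    exact v.map_add_lt (h x (Multiset.mem_cons_self x s))
      (ih fun y hy ↦ h y (Multiset.mem_cons_of_mem hy))

/-- The `q`-th powers stand in for the fractional bound `g ^ (1/q)`. The empty multiset is excluded
because it would give `1 < 1`. -/
theorem map_multiset_prod_pow_lt {s : Multiset K} (hs : s ≠ 0) {g : Γ₀} {q : ℕ}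
    (h : ∀ x ∈ s, v x ^ q < g) : v s.prod ^ q < g ^ s.card := by
  induction s using Multiset.induction_on with
  | empty => exact absurd rfl hs
  | cons x s ih =>
    have hx := h x (Multiset.mem_cons_self x s)
    rw [Multiset.prod_cons, map_mul, mul_pow, Multiset.card_cons, pow_succ']
    rcases eq_or_ne s 0 with rfl | hs'
    · simpa using hx
    · exact mul_lt_mul'' hx (ih hs' fun y hy ↦ h y (Multiset.mem_cons_of_mem hy)) zero_le
        zero_le

/-- By the ultrametric inequality it suffices to bound each product of `q` elements. Applied to
roots, this says that roots that are all too small force a small coefficient. -/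
theorem map_esymm_lt {s : Multiset K} {g : Γ₀} (hg : g ≠ 0) {q : ℕ} (hq : q ≠ 0)
    (h : ∀ x ∈ s, v x ^ q < g) : v (s.esymm q) < g := by
  refine v.map_multiset_sum_lt hg fun y hy ↦ ?_
  obtain ⟨t, ht, rfl⟩ := Multiset.mem_map.1 hy
  obtain ⟨hts, htq⟩ := Multiset.mem_powersetCard.1 ht
  have := v.map_multiset_prod_pow_lt (s := t) (g := g) (q := q)
    (by rintro rfl; exact hq (by simpa using htq.symm))
    fun x hx ↦ h x (Multiset.mem_of_le hts hx)
  rw [htq] at this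
  exact lt_of_pow_lt_pow_left₀ q zero_le this

section Root

variable {k m n : ℕ} {a c : ℤ} {x : K}

/-- If `v x > 1`, the leading term `x ^ (k * m)` would strictly dominate the right-hand side. -/
theorem map_le_one_of_pow_add_pow_eq (hn : n < k * m) (hx : (x ^ k + c) ^ m = a * x ^ n) :
    v x ≤ 1 := by
  by_contra! h
  have hk : k ≠ 0 := by rintro rfl; simp at hn
  have h1 : v (x ^ k + c) = v x ^ k := by
    rw [v.map_add_eq_of_lt_left, map_pow]
    rw [map_pow]
    exact (v.map_intCast_le_one c).trans_lt (one_lt_pow₀ h hk)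
  have h2 := congrArg v hx
  rw [map_pow, h1, ← pow_mul, map_mul, map_pow] at h2
  have h3 : v x ^ n < v x ^ (k * m) := pow_lt_pow_right₀ h hn
  rw [h2] at h3
  exact absurd (mul_le_of_le_one_left' (v.map_intCast_le_one a)) (not_le.2 h3)

/-- Otherwise `x ^ k` dominates `c`, so the equation reads `v x ^ (k * m) = v a * v x ^ n`;
cancelling `v x ^ n` gives `v x ^ q = v a`, a contradiction. -/
theorem map_pow_le_of_pow_add_pow_eq {q : ℕ} (hq : q ≠ 0) (hqn : q + n = k * m) (hkq : k ≤ q)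
    (hc : v (c : K) ≤ v (a : K)) (hx : (x ^ k + c) ^ m = a * x ^ n) : v x ^ q ≤ v (a : K) := by
  by_contra! h
  have hx1 := v.map_le_one_of_pow_add_pow_eq (by omega) hx
  have h1 : v (x ^ k + c) = v x ^ k := by
    rw [v.map_add_eq_of_lt_left, map_pow]
    rw [map_pow]
    exact (hc.trans_lt h).trans_le (pow_le_pow_right_of_le_one' hx1 hkq)
  have hx0 : v x ≠ 0 := by
    intro h0
    rw [h0, zero_pow hq] at h
    exact not_lt_zero h
  have h2 := congrArg v hx
  rw [map_pow, h1, ← pow_mul, map_mul, map_pow, ← hqn, pow_add] at h2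
  exact h.ne' (mul_right_cancel₀ (pow_ne_zero n hx0) h2)

/-- If `v x < 1`, the left-hand side would be a unit, while the right-hand side has valuation below
1. -/
theorem map_eq_one_of_pow_add_pow_eq (hn : n < k * m) (ha : v (a : K) < 1)
    (hc : v (c : K) = 1) (hx : (x ^ k + c) ^ m = a * x ^ n) : v x = 1 := by
  have hx1 := v.map_le_one_of_pow_add_pow_eq hn hx
  refine le_antisymm hx1 (not_lt.1 fun h ↦ ?_)
  have hk : k ≠ 0 := by rintro rfl; simp at hn
  have h1 : v (x ^ k + c) = 1 := by
    rw [v.map_add_eq_of_lt_right, hc]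
    rw [map_pow, hc]
    exact pow_lt_one₀ zero_le h hk
  have h2 := congrArg v hx
  rw [map_pow, h1, one_pow, map_mul, map_pow] at h2
  exact absurd h2 (mul_lt_one_of_lt_of_le ha (pow_le_one' hx1 n)).ne'

/-- The derivative of `(X ^ k + c) ^ m - a X ^ n` at a root `x`, in terms of valuations. -/
theorem map_eval_derivative_pow (hn : n < k * m) (ha : v (a : K) < 1) (hc : v (c : K) = 1)
    (hkm : v ((k * m : ℕ) : K) = 1) (hx : (x ^ k + c) ^ m = a * x ^ n) :
    v ((derivative ((X ^ k + C (c : K)) ^ m - C (a : K) * X ^ n)).eval x) ^ m =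
      v (a : K) ^ (m - 1) := by
  have hx1 := v.map_eq_one_of_pow_add_pow_eq hn ha hc hx
  have hk : k ≠ 0 := by rintro rfl; simp at hn
  have hm : m ≠ 0 := by rintro rfl; simp at hn
  obtain ⟨m, rfl⟩ := Nat.exists_eq_succ_of_ne_zero hm
  obtain ⟨k, rfl⟩ := Nat.exists_eq_succ_of_ne_zero hk
  have hy : v (x ^ (k + 1) + c) ^ (m + 1) = v (a : K) := by
    rw [← map_pow, hx, map_mul, map_pow, hx1, one_pow, mul_one]
  have hy1 : v (x ^ (k + 1) + c) < 1 := by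
    by_contra! h
    exact absurd hy (ha.trans_le (one_le_pow_of_one_le' h _)).ne'
  set d : K := (((k + 1) * (m + 1) : ℕ) : K) with hd
  -- The equation of the root replaces `a * x ^ n` by a power of `x ^ (k + 1) + c`, which then
  -- factors out. The remaining factor is a unit, since `d * c` is one and `x ^ (k + 1) + c` has
  -- valuation below 1.
  have hder : x * (derivative ((X ^ (k + 1) + C (c : K)) ^ (m + 1) - C (a : K) * X ^ n)).eval x =
      (x ^ (k + 1) + c) ^ m * ((d - n) * (x ^ (k + 1) + c) - d * c) := by
    have hxn : x * (n * x ^ (n - 1)) = n * x ^ n := by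
      rcases n with _ | n
      · simp
      · rw [Nat.add_sub_cancel]; ring
    have h1 : (a : K) * (x * (n * x ^ (n - 1))) = n * (x ^ (k + 1) + c) ^ (m + 1) := by
      rw [hxn, hx]; ring
    simp only [derivative_sub, derivative_mul, derivative_pow, derivative_add, derivative_X,
      derivative_C, eval_sub, eval_mul, eval_add, eval_pow, eval_X, eval_C, zero_mul, mul_one,
      add_zero, zero_add, eval_natCast, Nat.add_sub_cancel, map_natCast, mul_sub, hd]
    push_cast
    linear_combination -h1
  have hunit : v ((d - n) * (x ^ (k + 1) + c) - d * c) = 1 := by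
    rw [v.map_sub_eq_of_lt_right, map_mul, hkm, hc, one_mul]
    rw [map_mul, map_mul, hkm, hc, one_mul]
    refine mul_lt_one_of_nonneg_of_lt_one_right ?_ zero_le hy1
    have := v.map_intCast_le_one ((((k + 1) * (m + 1) : ℕ) : ℤ) - n)
    rw [hd]
    exact_mod_cast this
  have h2 := congrArg v hder
  rw [map_mul, hx1, one_mul, map_mul, hunit, mul_one, map_pow] at h2
  rw [h2, ← pow_mul, mul_comm, pow_mul, hy, Nat.succ_sub_one]

end Root

/-- The square of the Vandermonde determinant has the valuation of the product of the values of the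
derivative of the nodal polynomial. -/
theorem map_det_vandermonde_sq {d : ℕ} (α : Fin d → K) :
    v (Matrix.vandermonde α).det ^ 2 =
      ∏ i, v ((derivative (∏ j, (X - C (α j)))).eval (α i)) := by
  have h1 : ∀ i, v ((derivative (∏ j, (X - C (α j)))).eval (α i)) =
      ∏ j ∈ {i}ᶜ, v (α j - α i) := by
    intro i
    have := Lagrange.eval_nodal_derivative_eval_node_eq (s := Finset.univ) (v := α)
      (Finset.mem_univ i)
    rw [Lagrange.nodal_eq] at this
    rw [this, Lagrange.eval_nodal, map_prod, Finset.compl_singleton]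
    exact Finset.prod_congr rfl fun j _ ↦ v.map_sub_swap _ _
  simp only [h1]
  rw [← Finset.prod_prod_Ioi_mul_eq_prod_prod_off_diag, Matrix.det_vandermonde, map_prod, sq,
    ← Finset.prod_mul_distrib]
  refine Finset.prod_congr rfl fun i _ ↦ ?_
  rw [map_prod, ← Finset.prod_mul_distrib]
  exact Finset.prod_congr rfl fun j _ ↦ by rw [v.map_sub_swap (α i)]

theorem map_det_vandermonde_sq_eq_pow {k m n : ℕ} {a c : ℤ} (hn : n < k * m)
    (ha : v (a : K) < 1) (hc : v (c : K) = 1) (hkm : v ((k * m : ℕ) : K) = 1)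
    (α : Fin (k * m) → K)
    (hα : (X ^ k + C (c : K)) ^ m - C (a : K) * X ^ n = ∏ i, (X - C (α i))) :
    v (Matrix.vandermonde α).det ^ 2 = v (a : K) ^ (k * (m - 1)) := by
  have hm : m ≠ 0 := by rintro rfl; simp at hn
  have hroot : ∀ i, (α i ^ k + c) ^ m = a * α i ^ n := by
    intro i
    have h := congrArg (eval (α i)) hα
    rw [eval_prod, Finset.prod_eq_zero (Finset.mem_univ i) (by simp)] at h
    simpa [sub_eq_zero] using h
  rw [v.map_det_vandermonde_sq, ← hα]
  -- The derivative at each root is known only through its `m`-th power, so both sides are raised to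
  -- the power `m`.
  refine (pow_left_inj₀ zero_le zero_le hm).1 ?_
  rw [← Finset.prod_pow]
  rw [Finset.prod_congr rfl fun i _ ↦ v.map_eval_derivative_pow hn ha hc hkm (hroot i),
    Finset.prod_const, Finset.card_univ, Fintype.card_fin, ← pow_mul, ← pow_mul]
  congr 1
  ring

/-- If `p` divides `c` and exactly divides `a`, some root of `(X ^ k + c) ^ m - a X ^ n` has
valuation `v p / (k m - n)`. -/
theorem exists_root_map_pow_eq {k m n q : ℕ} {a c : ℤ} {p : ℕ} (hp : p.Prime)
    (hvp : v (p : K) < 1) (hp0 : (p : K) ≠ 0) (hm : 2 ≤ m) (hqn : q + n = k * m)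
    (hnq : n < q) (hc : (p : ℤ) ∣ c) (ha : (p : ℤ) ∣ a) (ha2 : ¬ (p : ℤ) ^ 2 ∣ a)
    (hsplit : ((X ^ k + C (c : K)) ^ m - C (a : K) * X ^ n).Splits) :
    ∃ x, v x ^ q = v (p : K) := by
  have hk : k ≠ 0 := by rintro rfl; omega
  have hkq : k ≤ q := by nlinarith
  obtain ⟨c', rfl⟩ := hc
  obtain ⟨a', rfl⟩ := ha
  have ha' : ¬ (p : ℤ) ∣ a' := fun ⟨w, hw⟩ ↦ ha2 ⟨w, by rw [hw]; ring⟩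
  have hva : v ((p * a' : ℤ) : K) = v (p : K) := by
    rw [Int.cast_mul, map_mul, v.map_intCast_eq_one_of_not_dvd hp hvp ha', mul_one, Int.cast_natCast]
  have hvc : v ((p * c' : ℤ) : K) ≤ v (p : K) := by
    rw [Int.cast_mul, map_mul, Int.cast_natCast]
    exact mul_le_of_le_one_right' (v.map_intCast_le_one c')
  set F : K[X] := (X ^ k + C ((p * c' : ℤ) : K)) ^ m - C ((p * a' : ℤ) : K) * X ^ n with hF
  have hn : n < k * m := by omega
  have hmonic : F.Monic := monic_X_pow_add_C_pow_sub hn _ _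
  have hdeg : F.natDegree = k * m := natDegree_X_pow_add_C_pow_sub hn _ _
  have hle : ∀ x ∈ F.roots, v x ^ q ≤ v (p : K) := by
    intro x hx
    rw [← hva]
    refine v.map_pow_le_of_pow_add_pow_eq (k := k) (m := m) (n := n) (c := p * c')
      (by omega) hqn hkq (hvc.trans_eq hva.symm) ?_
    have := (mem_roots'.1 hx).2
    rw [hF] at this
    simpa [IsRoot.def, sub_eq_zero] using this
  -- If no root attained the bound, the coefficient of `X ^ n`, up to sign the `q`-th elementary
  -- symmetric function of the roots, would have valuation below `v p`. Yet it is `-a` plus a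
  -- multiple of `c ^ 2`, hence exactly divisible by `p`.
  by_contra! hne
  have hlt := v.map_esymm_lt (s := F.roots) (g := v (p : K)) ((v.ne_zero_iff).2 hp0)
    (q := q) (by omega) fun x hx ↦ lt_of_le_of_ne (hle x hx) (hne x)
  have hcoeff : v (F.coeff n) = v (F.roots.esymm q) := by
    rw [coeff_eq_esymm_roots_of_splits hsplit (by omega), hmonic.leadingCoeff, one_mul, map_mul,
      map_pow, v.map_neg, map_one, one_pow, one_mul, hdeg, ← hqn, Nat.add_sub_cancel]
  rw [← hcoeff] at hlt
  obtain ⟨w, hw⟩ := sq_dvd_coeff_X_pow_add_C_pow (n := n) hk hm (by omega) ((p : ℤ) * c')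
  have hFn : F.coeff n = ((p * (p * (c' ^ 2 * w) - a') : ℤ) : K) := by
    have : F = ((X ^ k + C (p * c' : ℤ)) ^ m - C (p * a' : ℤ) * X ^ n).map
        (Int.castRingHom K) := by
      rw [map_X_pow_add_C_pow_sub]
      rfl
    rw [this, coeff_map, coeff_sub, hw, coeff_C_mul_X_pow, if_pos rfl, eq_intCast]
    congr 1
    ring
  have hnd : ¬ (p : ℤ) ∣ p * (c' ^ 2 * w) - a' := by
    rwa [dvd_sub_right (dvd_mul_right _ _)]
  rw [hFn, Int.cast_mul, map_mul, v.map_intCast_eq_one_of_not_dvd hp hvp hnd, mul_one,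
    Int.cast_natCast] at hlt
  exact lt_irrefl _ hlt

end Valuation

/-! ### Ramification in Galois number fields -/

open NumberField WithZero in
/-- Above every prime `p` a Galois number field has a discrete valuation for which the valuation of
`p` divides the order of the Galois group. -/
theorem NumberField.exists_valuation_eq_exp_neg (K : Type*) [Field K] [NumberField K]
    [IsGalois ℚ K] {p : ℕ} (hp : p.Prime) :
    ∃ (v : Valuation K (WithZero (Multiplicative ℤ))) (e : ℕ), v (p : K) = exp (-(e : ℤ)) ∧
      v (p : K) < 1 ∧ e ∣ Nat.card Gal(K/ℚ) := by
  have hpZ : Prime (p : ℤ) := Nat.prime_iff_prime_int.1 hp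
  let P : IsDedekindDomain.HeightOneSpectrum ℤ :=
    ⟨Ideal.span {(p : ℤ)}, (Ideal.span_singleton_prime hpZ.ne_zero).2 hpZ, by
      simpa using hp.ne_zero⟩
  have hPmax : P.asIdeal.IsMaximal := P.isMaximal
  obtain ⟨Q, hQ, hQP⟩ := Ideal.exists_maximal_ideal_liesOver_of_isIntegral (S := 𝓞 K) P.asIdeal
  let w : IsDedekindDomain.HeightOneSpectrum (𝓞 K) :=
    ⟨Q, hQ.isPrime, Ideal.ne_bot_of_liesOver_of_ne_bot P.ne_bot Q⟩
  have : w.asIdeal.LiesOver P.asIdeal := hQP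
  have hval := P.intValuation_liesOver w (p : ℤ)
  rw [P.intValuation_singleton (r := (p : ℤ)) hpZ.ne_zero rfl] at hval
  have hwp : w.valuation K (p : K) = exp (-(P.asIdeal.ramificationIdx' Q : ℤ)) := by
    have h : (p : K) = algebraMap (𝓞 K) K (algebraMap ℤ (𝓞 K) p) := by simp
    rw [h, w.valuation_of_algebraMap, ← hval, ← exp_nsmul]
    congr 1
    simp [w]
  refine ⟨w.valuation K, _, hwp, ?_, ?_⟩
  · rw [hwp, ← exp_zero, exp_lt_exp]
    have := Ideal.IsDedekindDomain.ramificationIdx'_ne_zero_of_liesOver Q P.ne_bot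
    omega
  -- In a Galois extension the group order is the number of primes above `P` times the ramification
  -- index times the inertia degree.
  · rw [Ideal.ramificationIdx'_eq_ramificationIdx P.asIdeal Q P.ne_bot,
      ← Ideal.ramificationIdxIn_eq_ramificationIdx P.asIdeal Q Gal(K/ℚ),
      ← Ideal.ncard_primesOver_mul_ramificationIdxIn_mul_inertiaDegIn P.asIdeal (𝓞 K) Gal(K/ℚ)]
    exact (dvd_mul_right _ _).mul_left _

/-! ### Consequences for the Galois group -/

namespace Polynomial

variable {k m n q : ℕ} {a c : ℤ}

/-- The prime `k m - n` divides the order of the Galois group of `(X ^ k + c) ^ m - a X ^ n`, by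
ramification at a prime dividing `c` and exactly dividing `a`. -/
theorem dvd_card_of_dvd_of_not_sq_dvd (K : Type*) [Field K] [NumberField K] [IsGalois ℚ K]
    {p : ℕ} (hp : p.Prime) (hm : 2 ≤ m) (hqn : q + n = k * m)
    (hnq : n < q) (hc : (p : ℤ) ∣ c) (ha : (p : ℤ) ∣ a) (ha2 : ¬ (p : ℤ) ^ 2 ∣ a)
    (hsplit : ((X ^ k + C (c : K)) ^ m - C (a : K) * X ^ n).Splits) :
    q ∣ Nat.card Gal(K/ℚ) := by
  obtain ⟨v, e, hve, hv1, he⟩ := NumberField.exists_valuation_eq_exp_neg K hp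
  have hp0 : (p : K) ≠ 0 := by exact_mod_cast hp.ne_zero
  obtain ⟨x, hx⟩ := v.exists_root_map_pow_eq hp hv1 hp0 hm hqn hnq hc ha ha2 hsplit
  have hx0 : v x ≠ 0 := by
    intro h
    rw [h, zero_pow (by omega), eq_comm, v.zero_iff] at hx
    exact hp0 hx
  refine dvd_trans ?_ he
  -- In additive form `v x ^ q = v p` says that `q` times an integer is `-e`.
  rw [hve, ← WithZero.exp_log hx0, ← WithZero.exp_nsmul, WithZero.exp_inj, nsmul_eq_mul] at hx
  exact Int.natCast_dvd_natCast.1 ⟨-WithZero.log (v x), by linarith⟩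

theorem prod_X_sub_C_rootSet {F K : Type*} [Field F] [Field K] [Algebra F K] {p : F[X]}
    [Fintype (p.rootSet K)] (hp : p.Monic) (hsep : p.Separable)
    (hsplit : (p.map (algebraMap F K)).Splits) :
    ∏ x : p.rootSet K, (X - C (x : K)) = p.map (algebraMap F K) := by
  classical
  rw [hsplit.eq_prod_roots_of_monic (hp.map _)]
  have hnd := nodup_roots (hsep.map (f := algebraMap F K))
  calc ∏ x : p.rootSet K, (X - C (x : K)) = ∏ x ∈ (p.map (algebraMap F K)).roots.toFinset,
        (X - C x) := (Finset.prod_subtype (p := (· ∈ p.rootSet K)) _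
          (fun x ↦ by simp only [rootSet_def, aroots_def, Finset.mem_coe]) (X - C ·)).symm
    _ = _ := by rw [Finset.prod_eq_multiset_prod, Multiset.toFinset_val, hnd.dedup]

open Equiv.Perm in
/-- A finite Galois group acting by even permutations on the `α i` fixes their Vandermonde
determinant. -/
theorem det_vandermonde_mem_range_algebraMap {F K : Type*} [Field F] [Field K] [Algebra F K]
    [FiniteDimensional F K] [IsGalois F K] {d : ℕ} (α : Fin d → K)
    (h : ∀ φ : Gal(K/F), ∃ τ : Equiv.Perm (Fin d), sign τ = 1 ∧ ∀ i, φ (α i) = α (τ i)) :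
    (Matrix.vandermonde α).det ∈ Set.range (algebraMap F K) := by
  rw [IsGalois.mem_range_algebraMap_iff_fixed]
  intro φ
  obtain ⟨τ, hτ, hφ⟩ := h φ
  have h1 : φ (Matrix.vandermonde α).det = ((Matrix.vandermonde α).submatrix τ id).det := by
    rw [AlgEquiv.map_det]
    congr 1
    ext i j
    simp [Matrix.vandermonde_apply, hφ]
  rw [h1, Matrix.det_permute, hτ]
  simp

end Polynomial

/-! ### The main theorem -/

theorem theorem2p12 (k m n : ℕ) (hk : 1 ≤ k) (hm : 1 ≤ m) (hn : 1 ≤ n) (hnkm : n < k * m)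
    (a c : ℤ) (f : ℤ[X]) (hf : f = (X ^ k + C c) ^ m - C a * X ^ n)
    (hirr : Irreducible (f.map (Int.castRingHom ℚ)))
    (d q : ℕ) (hd : d = k * m) (hq : q = k * m - n)
    (hqprime : q.Prime) (hdq : (d : ℚ) / 2 < q) (hqd : (q : ℚ) < (d : ℚ) - 2)
    (hp : ∃ p : ℕ, p.Prime ∧ (p : ℤ) ∣ c ∧ (p : ℤ) ∣ a ∧ ¬ (p : ℤ) ^ 2 ∣ a)
    (hodd : Odd (k * (m - 1)))
    (hl : ∃ l : ℕ, l.Prime ∧ Odd (padicValInt l a) ∧ ¬ (l : ℤ) ∣ (k : ℤ) * (m : ℤ) * c) :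
    Nonempty ((f.map (Int.castRingHom ℚ)).Gal ≃* Equiv.Perm (Fin d)) := by
  classical
  subst hd
  have hm2 : 2 ≤ m := by
    by_contra! h
    obtain rfl : m = 1 := by omega
    simp at hodd
  have hqn : q + n = k * m := by omega
  have hlt : k * m < 2 * q := by
    rw [div_lt_iff₀ two_pos] at hdq
    have : ((k * m : ℕ) : ℚ) < ((2 * q : ℕ) : ℚ) := by push_cast at hdq ⊢; linarith
    exact_mod_cast this
  have hq3 : q + 3 ≤ k * m := by
    have : ((q + 2 : ℕ) : ℚ) < ((k * m : ℕ) : ℚ) := by push_cast at hqd ⊢; linarith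
    have : q + 2 < k * m := by exact_mod_cast this
    omega
  have hfQ : f.map (Int.castRingHom ℚ) = (X ^ k + C (c : ℚ)) ^ m - C (a : ℚ) * X ^ n := by
    rw [hf, map_X_pow_add_C_pow_sub]
    rfl
  set g : ℚ[X] := f.map (Int.castRingHom ℚ) with hg
  obtain ⟨K, _, _, _⟩ :
      ∃ (K : Type) (_ : Field K) (_ : NumberField K), IsSplittingField ℚ K g := by
    refine ⟨g.SplittingField, inferInstance, { }, ?_⟩
    -- The two `ℚ`-algebra structures on the splitting field agree, since a `ℚ`-algebra structure is
    -- unique.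
    convert IsSplittingField.splittingField g
    exact Subsingleton.elim _ _
  have hsplit : (g.map (algebraMap ℚ K)).Splits := IsSplittingField.splits K g
  have := Fact.mk hsplit
  have hgK : g.map (algebraMap ℚ K) = (X ^ k + C (c : K)) ^ m - C (a : K) * X ^ n := by
    rw [hfQ, map_X_pow_add_C_pow_sub, map_intCast (algebraMap ℚ K), map_intCast (algebraMap ℚ K)]
  have : IsGalois ℚ K := IsGalois.of_separable_splitting_field hirr.separable
  have hcard : Fintype.card (g.rootSet K) = k * m := by
    rw [card_rootSet_eq_natDegree hirr.separable hsplit, hfQ, natDegree_X_pow_add_C_pow_sub hnkm]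
  let G : Subgroup (Equiv.Perm (g.rootSet K)) := (Gal.galActionHom g K).range
  have hGtrans : MulAction.IsPretransitive G (g.rootSet K) := by
    have := Gal.galAction_isPretransitive g K hirr
    refine ⟨fun x y ↦ ?_⟩
    obtain ⟨φ, hφ⟩ := MulAction.exists_smul_eq g.Gal x y
    exact ⟨⟨_, φ, rfl⟩, hφ⟩
  have hA : alternatingGroup (g.rootSet K) ≤ G := by
    obtain ⟨p, hp, hpc, hpa, hpa2⟩ := hp
    have := Fact.mk hqprime
    have hdvd : q ∣ Nat.card g.Gal := by
      rw [Gal.card_of_separable hirr.separable,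
        ← (IsSplittingField.algEquiv K g).toLinearEquiv.finrank_eq, ← IsGalois.card_aut_eq_finrank]
      exact dvd_card_of_dvd_of_not_sq_dvd K hp hm2 hqn (by omega) hpc hpa hpa2 (hgK ▸ hsplit)
    obtain ⟨φ, hφ⟩ := exists_prime_orderOf_dvd_card' q hdvd
    have hord : orderOf (Gal.galActionHom g K φ) = q := by
      rw [orderOf_injective _ (Gal.galActionHom_injective g K), hφ]
    -- A permutation of prime order `q` is a product of disjoint `q`-cycles, and fewer than `2 * q`
    -- points leave room for only one.
    have hcyc : (Gal.galActionHom g K φ).IsCycle :=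
      Equiv.Perm.isCycle_of_prime_order' (by rwa [hord]) (by rw [hord, hcard]; exact hlt)
    have hsupp : (Gal.galActionHom g K φ).support.card = q := by rw [← hcyc.orderOf, hord]
    have hprim := Equiv.Perm.isPreprimitive_of_isCycle_mem (G := G) hqprime
      (by rw [hcard]; exact hlt) hcyc hsupp ⟨φ, rfl⟩
    exact Equiv.Perm.alternatingGroup_le_of_isPreprimitive_of_isCycle_mem hprim hqprime
      (by rw [Nat.card_eq_fintype_card, hcard]; exact hq3) hcyc hsupp ⟨φ, rfl⟩
  have hnA : ¬ G ≤ alternatingGroup (g.rootSet K) := by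
    intro hle
    obtain ⟨l, hl, hla, hlc⟩ := hl
    obtain ⟨v, -, -, hv1, -⟩ := NumberField.exists_valuation_eq_exp_neg K hl
    have ha0 : a ≠ 0 := by
      rintro rfl
      simp at hla
    have hva : v (a : K) < 1 := by
      rw [v.map_intCast_eq_pow_padicValInt hl hv1 ha0]
      exact pow_lt_one₀ zero_le hv1 hla.pos.ne'
    have hvc : v (c : K) = 1 :=
      v.map_intCast_eq_one_of_not_dvd hl hv1 fun h ↦ hlc (h.mul_left _)
    have hvkm : v ((k * m : ℕ) : K) = 1 := by
      have := v.map_intCast_eq_one_of_not_dvd hl hv1 (z := (k * m : ℕ)) fun h ↦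
        hlc (Dvd.dvd.mul_right (by exact_mod_cast h) _)
      rwa [Int.cast_natCast] at this
    let ε : Fin (k * m) ≃ g.rootSet K := (Fintype.equivFinOfCardEq hcard).symm
    have hprod : (X ^ k + C (c : K)) ^ m - C (a : K) * X ^ n = ∏ i, (X - C (ε i : K)) := by
      rw [← hgK, ← prod_X_sub_C_rootSet ?_ hirr.separable hsplit]
      · exact (Equiv.prod_comp ε fun x : g.rootSet K ↦ X - C (x : K)).symm
      · rw [hfQ]
        exact monic_X_pow_add_C_pow_sub hnkm _ _
    have hδ := v.map_det_vandermonde_sq_eq_pow hnkm hva hvc hvkm (fun i ↦ (ε i : K)) hprod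
    -- Even permutations of the roots fix the square root of the discriminant, which is therefore a
    -- rational number `r`.
    obtain ⟨r, hr⟩ := det_vandermonde_mem_range_algebraMap (F := ℚ) (fun i ↦ (ε i : K)) (by
      intro φ
      let τ := Gal.galActionHom g K (Gal.restrict g K φ)
      refine ⟨ε.symm.permCongr τ, ?_, fun i ↦ ?_⟩
      · rw [Equiv.Perm.sign_permCongr]
        exact Equiv.Perm.mem_alternatingGroup.1 (hle ⟨_, rfl⟩)
      · rw [← Gal.galActionHom_restrict]
        simp [τ, Equiv.permCongr_apply])
    rw [← hr, eq_ratCast] at hδ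
    exact Nat.not_even_iff_odd.2 hla (v.even_padicValInt_of_sq_eq_pow hl hv1 ha0 hodd hδ)
  have hG : G = ⊤ :=
    Equiv.Perm.eq_top_of_alternatingGroup_le_of_not_le hA hnA
  exact ⟨(MulEquiv.ofBijective (Gal.galActionHom g K)
    ⟨Gal.galActionHom_injective g K, MonoidHom.range_eq_top.1 hG⟩).trans
      (Fintype.equivFinOfCardEq hcard).permCongrHom⟩
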